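/- Let $m\ge 3$ and $n\ge 1$ be integers. For a real $n\times m$ matrix $\Theta=(\theta_j^i)$ and $\mathbf x\in\mathbb Z^m$ put $L_j(\mathbf x)=\sum_{i=1}^m\theta_j^i x_i$, $M(\mathbf x)=\max_i|x_i|$ and $\zeta(\mathbf x)=\max_{1\le j\le n}\|L_j(\mathbf x)\|$, where $\|\cdot\|$ is the distance to the nearest integer. A nonzero $\mathbf x\in\mathbb Z^m$ is a best approximation for $\Theta$ if $\zeta(\mathbf x)\le\zeta(\mathbf x')$ for all $\mathbf x'\in\mathbb Z^m$ with $0<M(\mathbf x')\le M(\mathbf x)$. The best approximations are arranged in a sequence $\mathbf x_1,\mathbf x_2,\dots$ with $M(\mathbf x_1)<M(\mathbf x_2)<\dots$ and $\zeta(\mathbf x_1)>\zeta(\mathbf x_2)>\dots$, in which every value that $\zeta$ takes at a best approximation occurs, at the least possible $M$. The matrix $\Theta$ is called regular if this sequence is infinite and $\mathbf x_\nu$ is unique up to sign for all large $\nu$. Let $\mathbf z_\nu=(\mathbf x_\nu,\mathbf y_\nu)\in\mathbb Z^{m+n}$, where $\mathbf y_\nu\in\mathbb Z^n$ satisfies $|L_j(\mathbf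 x_\nu)+y_{j,\nu}|=\|L_j(\mathbf x_\nu)\|$ for all $j$. For regular $\Theta$ let $R(\Theta)$ be the least $r$ for which some sublattice $\Lambda\subseteq\mathbb Z^{m+n}$ whose real linear span has dimension $r$ contains $\mathbf z_\nu$ for all sufficiently large $\nu$. Theorem. For every $m\ge3$ and every $n\ge1$ there is a real $n\times m$ matrix $\Theta$ whose $mn$ entries are, together with $1$, linearly independent over $\mathbb Z$ (in particular $\Theta$ is regular), and such that for all sufficiently large $\nu$ the best approximation vectors $\mathbf z_\nu$ lie in a fixed $3$-dimensional linear subspace of $\mathbb R^{m+n}$; moreover $R(\Theta)=3$. -/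

import Mathlib

namespace BestApprox

noncomputable section

variable {n m : ℕ}

/-- The linear form `L_j(x) = ∑ i, θ_j^i x_i` of the real matrix `Θ`, at an integer vector. -/
def linForm (Θ : Matrix (Fin n) (Fin m) ℝ) (x : Fin m → ℤ) (j : Fin n) : ℝ :=
  ∑ i, Θ j i * (x i : ℝ)

/-- The distance to the nearest integer. -/
def distInt (t : ℝ) : ℝ := |t - round t|

/-- The height `M(x) = max_i |x_i|`. -/
def height (x : Fin m → ℤ) : ℕ := Finset.univ.sup fun i => (x i).natAbs

/-- `ζ(x) = max_j ‖L_j(x)‖`, with `‖·‖` the distance to the nearest integer. -/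
def zeta (Θ : Matrix (Fin n) (Fin m) ℝ) (x : Fin m → ℤ) : ℝ :=
  ⨆ j, distInt (linForm Θ x j)

/-- A nonzero integer vector `x` is a best approximation if `ζ(x)` is the minimum of `ζ` over
all integer vectors `x'` with `0 < M(x') ≤ M(x)`. -/
def IsBest (Θ : Matrix (Fin n) (Fin m) ℝ) (x : Fin m → ℤ) : Prop :=
  0 < height x ∧
    ∀ x' : Fin m → ℤ, 0 < height x' → height x' ≤ height x → zeta Θ x ≤ zeta Θ x'

/-- `x` is an (infinite) sequence of best approximations of `Θ`: the heights increase strictly,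
the values of `ζ` decrease strictly, and no level is left out: the value of `ζ` at each best
approximation is attained in the sequence, at the smallest possible height. -/
structure IsBestSeq (Θ : Matrix (Fin n) (Fin m) ℝ) (x : ℕ → Fin m → ℤ) : Prop where
  isBest : ∀ ν, IsBest Θ (x ν)
  height_lt : StrictMono fun ν => height (x ν)
  zeta_gt : StrictAnti fun ν => zeta Θ (x ν)
  complete : ∀ x', IsBest Θ x' → ∃ ν, zeta Θ (x ν) = zeta Θ x' ∧ height (x ν) ≤ height x'

/-- `Θ` is regular (in the sense of best approximations): the sequence of best approximations
is infinite and its terms are, from some index on, determined uniquely up to sign. -/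
def IsRegular (Θ : Matrix (Fin n) (Fin m) ℝ) : Prop :=
  ∃ x : ℕ → Fin m → ℤ, IsBestSeq Θ x ∧
    ∃ ν₀, ∀ ν ≥ ν₀, ∀ x', IsBest Θ x' → height x' = height (x ν) → x' = x ν ∨ x' = -x ν

/-- The extended vector `z = (x, y)` in `ℤ^(m+n)`, where `|L_j(x) + y_j| = ‖L_j(x)‖`. -/
def extVec (Θ : Matrix (Fin n) (Fin m) ℝ) (x : Fin m → ℤ) : Fin m ⊕ Fin n → ℤ :=
  Sum.elim x fun j => -round (linForm Θ x j)

/-- The inclusion of `ℤ^(m+n)` in `ℝ^(m+n)`. -/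
def toReal (z : Fin m ⊕ Fin n → ℤ) : Fin m ⊕ Fin n → ℝ := fun k => (z k : ℝ)

/-- The dimension of a sublattice of `ℤ^(m+n)`: that of its real linear span. -/
def latticeDim (Λ : AddSubgroup (Fin m ⊕ Fin n → ℤ)) : ℕ :=
  Module.finrank ℝ (Submodule.span ℝ (toReal '' (Λ : Set (Fin m ⊕ Fin n → ℤ))))

/-- `R(Θ)`, for regular `Θ`: the least dimension of a sublattice of `ℤ^(m+n)` that contains all
but finitely many of the extended best approximation vectors. -/
def R (Θ : Matrix (Fin n) (Fin m) ℝ) : ℕ :=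
  sInf {r : ℕ | ∃ Λ : AddSubgroup (Fin m ⊕ Fin n → ℤ), latticeDim Λ = r ∧
    ∀ x : ℕ → Fin m → ℤ, IsBestSeq Θ x → ∃ ν₀, ∀ ν ≥ ν₀, extVec Θ (x ν) ∈ Λ}

/-- The entries of `Θ` are, together with `1`, linearly independent over `ℤ`. -/
def EntriesIndep (Θ : Matrix (Fin n) (Fin m) ℝ) : Prop :=
  LinearIndependent ℤ fun o : Option (Fin n × Fin m) => o.elim (1 : ℝ) fun p => Θ p.1 p.2

end

end BestApprox

/-!
Let `m = k + 3`. Take the matrix with rows `(a β_j0, b β_j0, β_j0, β_j1, …, β_jk)`, so that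
`L_j(x) = β_j0 (x₀ a + x₁ b + x₂) + β_j1 x₃ + … + β_jk x_{k+2}`. On integer vectors supported on
the first three coordinates all the forms `L_j` are multiples of the single form
`x₀ a + x₁ b + x₂`, and where this form is small the nearest integers to the `L_j` are all `0`.

The pair `(a, b)` is chosen extremely singular (`exists_singular_pair`): `1, a, b` are independent,
and below every large height `X` the form `x₀ a + x₁ b + x₂` takes a nonzero value smaller than any
prescribed power of `1 / X`. The even and odd parts of the series `∑ 2 ^ (-i!)` will do. The
parameters `β` are chosen at random in `[1, 2]`. Almost surely the entries are independent, and by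
Borel–Cantelli (`ae_eventually_le_distInt`) every vector that is not of the above kind has `ζ`
bounded below by a fixed power of its height. Such a vector loses against the vectors provided by
singularity, so all large best approximations lie in the space spanned by the first three
coordinate vectors.

Regularity follows from independence, since `ζ(x) = ζ(x')` forces `x' = ± x`
(`EntriesIndep.isRegular`). That no space of dimension less than `3` suffices
(`IsBestSeq.not_eventually_mem_plane`) is due to singularity again: if consecutive best
approximations `x`, `y` lie in a fixed real plane, their vector product is a nonzero integer vector
in a fixed direction, so its vector product with `(a, b, 1)` is bounded below unless that direction
is `(a, b, 1)` itself. But it equals `e' x - e y`, where `e`, `e'` are the values of the form at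
`x`, `y`, and `e` is far smaller than the reciprocal of the height of `y`.
-/

namespace BestApprox

noncomputable section

/-! ### Heights, best approximations and regularity -/

section

variable {n m : ℕ}

lemma distInt_nonneg (t : ℝ) : 0 ≤ distInt t := abs_nonneg _

lemma round_eq_zero_of_abs_lt {t : ℝ} (ht : |t| < 1 / 2) : round t = 0 := by
  rw [abs_lt] at ht
  rw [round_eq_zero_iff]
  constructor <;> linarith [ht.1, ht.2]

lemma distInt_eq_abs {t : ℝ} (ht : |t| < 1 / 2) : distInt t = |t| := by
  simp [distInt, round_eq_zero_of_abs_lt ht]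

lemma distInt_linForm_le_zeta (Θ : Matrix (Fin n) (Fin m) ℝ) (x : Fin m → ℤ) (j : Fin n) :
    distInt (linForm Θ x j) ≤ zeta Θ x :=
  le_ciSup (f := fun j => distInt (linForm Θ x j)) (Set.finite_range _).bddAbove j

lemma exists_zeta_eq [NeZero n] (Θ : Matrix (Fin n) (Fin m) ℝ) (x : Fin m → ℤ) :
    ∃ j, zeta Θ x = distInt (linForm Θ x j) := by
  obtain ⟨j, hj⟩ := exists_eq_ciSup_of_finite (f := fun j => distInt (linForm Θ x j))
  exact ⟨j, hj.symm⟩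

lemma height_le_iff {x : Fin m → ℤ} {h : ℕ} : height x ≤ h ↔ ∀ i, (x i).natAbs ≤ h := by
  simp [height]

lemma height_pos_iff {x : Fin m → ℤ} : 0 < height x ↔ x ≠ 0 := by
  rw [← not_iff_not, not_lt, height_le_iff, not_not, funext_iff]
  simp

lemma abs_le_height (x : Fin m → ℤ) (i : Fin m) : |(x i : ℝ)| ≤ height x := by
  rw [← Int.cast_abs, Int.abs_eq_natAbs, Int.cast_natCast, Nat.cast_le]
  exact height_le_iff.1 le_rfl i

lemma exists_abs_eq_height {x : Fin m → ℤ} (hx : 0 < height x) :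
    ∃ i, |(x i : ℝ)| = height x := by
  have : (Finset.univ : Finset (Fin m)).Nonempty := by
    by_contra h
    rw [Finset.not_nonempty_iff_eq_empty] at h
    simp [height, h] at hx
  obtain ⟨i, -, hi⟩ := Finset.exists_mem_eq_sup _ this fun i => (x i).natAbs
  refine ⟨i, ?_⟩
  rw [height, hi, ← Int.cast_abs, Int.abs_eq_natAbs, Int.cast_natCast]

lemma mem_piFinset_Icc_iff {x : Fin m → ℤ} {h : ℕ} :
    x ∈ Fintype.piFinset (fun _ : Fin m => Finset.Icc (-(h : ℤ)) h) ↔ height x ≤ h := by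
  simp only [Fintype.mem_piFinset, Finset.mem_Icc, height_le_iff]
  exact forall_congr' fun i => by omega

/-- Below any height, the minimum of `ζ` over nonzero vectors is attained at a best
approximation. -/
lemma exists_isBest_le (Θ : Matrix (Fin n) (Fin m) ℝ) {x : Fin m → ℤ} (hx : 0 < height x) :
    ∃ y, IsBest Θ y ∧ height y ≤ height x ∧
      ∀ x', 0 < height x' → height x' ≤ height x → zeta Θ y ≤ zeta Θ x' := by
  obtain ⟨y, hy, hmin⟩ := Finset.exists_min_image
    ((Fintype.piFinset fun _ : Fin m => Finset.Icc (-(height x : ℤ)) (height x)).filter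
      fun y => 0 < height y) (zeta Θ) ⟨x, by
        rw [Finset.mem_filter, mem_piFinset_Icc_iff]; exact ⟨le_rfl, hx⟩⟩
  simp only [Finset.mem_filter, mem_piFinset_Icc_iff] at hy hmin
  exact ⟨y, ⟨hy.2, fun x' h1 h2 => hmin x' ⟨h2.trans hy.1, h1⟩⟩, hy.1,
    fun x' h1 h2 => hmin x' ⟨h2, h1⟩⟩

/-- `h` is a record height: some vector of height `h` has strictly smaller `ζ` than all nonzero
vectors of smaller height, and is a best approximation. -/
def IsRecord (Θ : Matrix (Fin n) (Fin m) ℝ) (h : ℕ) : Prop :=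
  ∃ y, IsBest Θ y ∧ height y = h ∧ ∀ x', 0 < height x' → height x' < h → zeta Θ y < zeta Θ x'

/-- The least height at which `ζ` takes a value `≤ δ` carries a best approximation. -/
lemma exists_isBest_zeta_le (Θ : Matrix (Fin n) (Fin m) ℝ) {δ : ℝ} {x : Fin m → ℤ}
    (hx : 0 < height x) (hδ : zeta Θ x ≤ δ) :
    ∃ y, IsBest Θ y ∧ height y ≤ height x ∧ zeta Θ y ≤ δ ∧
      ∀ x', 0 < height x' → height x' < height y → δ < zeta Θ x' := by
  classical
  have hex : ∃ h, ∃ y, 0 < height y ∧ height y = h ∧ zeta Θ y ≤ δ := ⟨_, x, hx, rfl, hδ⟩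
  obtain ⟨w, hw0, hwh, hwδ⟩ := Nat.find_spec hex
  have hlow : ∀ x', 0 < height x' → height x' < height w → δ < zeta Θ x' := by
    intro x' h1 h2
    by_contra! h3
    exact Nat.find_min hex (hwh ▸ h2) ⟨x', h1, rfl, h3⟩
  obtain ⟨y, hy, hyw, hmin⟩ := exists_isBest_le Θ hw0
  have hyδ : zeta Θ y ≤ δ := (hmin w hw0 le_rfl).trans hwδ
  have hle : height w ≤ height x := by
    rw [hwh]
    exact Nat.find_min' hex ⟨x, hx, rfl, hδ⟩
  exact ⟨y, hy, hyw.trans hle, hyδ, fun x' h1 h2 => hlow x' h1 (h2.trans_le hyw)⟩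

/-- If `ζ` is positive on nonzero vectors and has infimum `0`, enumerating the record heights
gives the infinite sequence of best approximations. -/
theorem exists_isBestSeq {Θ : Matrix (Fin n) (Fin m) ℝ}
    (hpos : ∀ x, 0 < height x → 0 < zeta Θ x)
    (hinf : ∀ ε > 0, ∃ x, 0 < height x ∧ zeta Θ x < ε) :
    ∃ x : ℕ → Fin m → ℤ, IsBestSeq Θ x := by
  classical
  have hS : {h | IsRecord Θ h}.Infinite := by
    refine Set.infinite_of_not_bddAbove ?_
    rintro ⟨H, hH⟩
    have hd : ∃ δ > 0, ∀ x', 0 < height x' → height x' ≤ H → δ < zeta Θ x' := by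
      by_cases hne : ∃ u : Fin m → ℤ, 0 < height u ∧ height u ≤ H
      · obtain ⟨u, hu, huH⟩ := hne
        obtain ⟨v, hv, hmin⟩ := Finset.exists_min_image
          ((Fintype.piFinset fun _ : Fin m => Finset.Icc (-(H : ℤ)) H).filter
            fun y => 0 < height y) (zeta Θ) ⟨u, by
              rw [Finset.mem_filter, mem_piFinset_Icc_iff]; exact ⟨huH, hu⟩⟩
        simp only [Finset.mem_filter, mem_piFinset_Icc_iff] at hv hmin
        have := hpos v hv.2
        exact ⟨zeta Θ v / 2, by positivity, fun x' h1 h2 => by linarith [hmin x' ⟨h2, h1⟩]⟩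
      · exact ⟨1, one_pos, fun x' h1 h2 => absurd ⟨x', h1, h2⟩ hne⟩
    obtain ⟨δ, hδ, hlow⟩ := hd
    obtain ⟨x, hx, hxδ⟩ := hinf δ hδ
    obtain ⟨z, hz, -, hzd, hzlow⟩ := exists_isBest_zeta_le Θ hx hxδ.le
    have hzH : height z ≤ H := hH ⟨z, hz, rfl, fun x' h1 h2 => hzd.trans_lt (hzlow x' h1 h2)⟩
    exact absurd hzd (not_le.2 (hlow z hz.1 hzH))
  have hmem : ∀ ν, IsRecord Θ (Nat.nth (IsRecord Θ) ν) := fun ν => Nat.nth_mem_of_infinite hS ν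
  choose x hx hxh hxlow using hmem
  have hmono : StrictMono fun ν => height (x ν) := by
    simpa only [hxh] using Nat.nth_strictMono hS
  refine ⟨x, hx, hmono, ?_, ?_⟩
  · intro ν μ h
    exact hxlow μ (x ν) (hx ν).1 ((hmono h).trans_eq (hxh μ))
  · intro x' hx'
    obtain ⟨y, hy, hyh, hyd, hylow⟩ := exists_isBest_zeta_le Θ hx'.1 le_rfl
    obtain ⟨ν, hν⟩ : ∃ ν, Nat.nth (IsRecord Θ) ν = height y := by
      have : height y ∈ Set.range (Nat.nth (IsRecord Θ)) := by
        rw [Nat.range_nth_of_infinite hS]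
        exact ⟨y, hy, rfl, fun x' h1 h2 => hyd.trans_lt (hylow x' h1 h2)⟩
      exact this
    have hh : height (x ν) = height y := (hxh ν).trans hν
    refine ⟨ν, le_antisymm ?_ ?_, hh.trans_le hyh⟩
    · exact ((hx ν).2 y hy.1 hh.ge).trans hyd
    · exact hx'.2 _ (hx ν).1 (hh.trans_le hyh)

/-- Consecutive best approximations: nothing below the height of `x (ν + 1)` beats `x ν`. -/
lemma IsBestSeq.zeta_le {Θ : Matrix (Fin n) (Fin m) ℝ} {x : ℕ → Fin m → ℤ} (hx : IsBestSeq Θ x)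
    {ν : ℕ} {u : Fin m → ℤ} (hu : 0 < height u) (hlt : height u < height (x (ν + 1))) :
    zeta Θ (x ν) ≤ zeta Θ u := by
  obtain ⟨y, hy, hyu, hmin⟩ := exists_isBest_le Θ hu
  obtain ⟨μ, hμ, hμh⟩ := hx.complete y hy
  have h1 : μ < ν + 1 := hx.height_lt.lt_iff_lt.1 ((hμh.trans hyu).trans_lt hlt)
  calc zeta Θ (x ν) ≤ zeta Θ (x μ) := hx.zeta_gt.antitone (Nat.lt_succ_iff.1 h1)
    _ = zeta Θ y := hμ
    _ ≤ zeta Θ u := hmin u hu le_rfl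

lemma entriesIndep_iff {Θ : Matrix (Fin n) (Fin m) ℝ} :
    EntriesIndep Θ ↔ ∀ (r : ℤ) (A : Fin n → Fin m → ℤ),
      (r : ℝ) + ∑ j, linForm Θ (A j) j = 0 → r = 0 ∧ A = 0 := by
  rw [EntriesIndep, Fintype.linearIndependent_iff]
  constructor
  · intro h r A hA
    have := h (fun o => o.elim r fun p => A p.1 p.2) (by
      rw [Fintype.sum_option, Fintype.sum_prod_type]
      simpa [linForm, mul_comm] using hA)
    refine ⟨this none, ?_⟩
    ext j i
    exact this (some (j, i))
  · intro h g hg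
    rw [Fintype.sum_option, Fintype.sum_prod_type] at hg
    obtain ⟨h1, h2⟩ := h (g none) (fun j i => g (some (j, i))) (by
      simpa [linForm, mul_comm] using hg)
    rintro (_ | ⟨j, i⟩)
    · exact h1
    · exact congr_fun (congr_fun h2 j) i

/-- For independent entries, values of the linear forms at `x ≠ 0` and `x'` can only be congruent
modulo `1` if `x' = x`. -/
lemma EntriesIndep.eq_of_linForm {Θ : Matrix (Fin n) (Fin m) ℝ} (hΘ : EntriesIndep Θ)
    {x x' : Fin m → ℤ} (hx : x ≠ 0) {j k : Fin n} {r : ℤ}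
    (h : linForm Θ x j = linForm Θ x' k + r) : x' = x := by
  rw [entriesIndep_iff] at hΘ
  have hA := (hΘ (-r) (Pi.single j x - Pi.single k x') (by
    have : ∀ j', linForm Θ ((Pi.single j x - Pi.single k x' : Fin n → Fin m → ℤ) j') j' =
        (if j' = j then linForm Θ x j' else 0) - (if j' = k then linForm Θ x' j' else 0) := by
      intro j'
      simp only [linForm, Pi.sub_apply, Int.cast_sub, mul_sub, Finset.sum_sub_distrib]
      congr 1
      · by_cases hj : j' = j
        · subst hj; simp
        · simp [hj]
      · by_cases hj : j' = k
        · subst hj; simp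
        · simp [hj]
    simp only [this, Finset.sum_sub_distrib, Finset.sum_ite_eq', Finset.mem_univ, if_true, h]
    push_cast
    ring)).2
  have hj := congr_fun hA j
  by_cases hjk : j = k
  · subst hjk
    simp only [Pi.sub_apply, Pi.single_eq_same, Pi.zero_apply, sub_eq_zero] at hj
    exact hj.symm
  · simp [hjk, hx] at hj

lemma linForm_neg (Θ : Matrix (Fin n) (Fin m) ℝ) (x : Fin m → ℤ) (j : Fin n) :
    linForm Θ (-x) j = -linForm Θ x j := by
  simp [linForm]

/-- For independent entries the value of `ζ` determines a nonzero vector up to sign. -/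
lemma EntriesIndep.eq_or_eq_neg [NeZero n] {Θ : Matrix (Fin n) (Fin m) ℝ} (hΘ : EntriesIndep Θ)
    {x x' : Fin m → ℤ} (hx : x ≠ 0) (h : zeta Θ x = zeta Θ x') : x' = x ∨ x' = -x := by
  obtain ⟨j, hj⟩ := exists_zeta_eq Θ x
  obtain ⟨k, hk⟩ := exists_zeta_eq Θ x'
  rw [hj, hk, distInt, distInt, abs_eq_abs] at h
  rcases h with h | h
  · left
    refine hΘ.eq_of_linForm hx (j := j) (k := k)
      (r := round (linForm Θ x j) - round (linForm Θ x' k)) ?_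
    push_cast
    linarith
  · right
    rw [← neg_eq_iff_eq_neg]
    refine hΘ.eq_of_linForm hx (j := j) (k := k)
      (r := round (linForm Θ x j) + round (linForm Θ x' k)) ?_
    rw [linForm_neg]
    push_cast
    linarith

lemma EntriesIndep.zeta_pos [NeZero n] {Θ : Matrix (Fin n) (Fin m) ℝ} (hΘ : EntriesIndep Θ)
    {x : Fin m → ℤ} (hx : 0 < height x) : 0 < zeta Θ x := by
  rw [height_pos_iff] at hx
  refine lt_of_lt_of_le (lt_of_le_of_ne (distInt_nonneg _) fun h => hx ?_)
    (distInt_linForm_le_zeta Θ x 0)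
  refine (hΘ.eq_of_linForm hx (x' := 0) (j := 0) (k := 0) (r := round (linForm Θ x 0)) ?_).symm
  have := abs_eq_zero.1 h.symm
  rw [sub_eq_zero] at this
  rw [← this]
  simp [linForm]

/-- Independent entries and `inf ζ = 0` make `Θ` regular. -/
theorem EntriesIndep.isRegular [NeZero n] {Θ : Matrix (Fin n) (Fin m) ℝ} (hΘ : EntriesIndep Θ)
    (hinf : ∀ ε > 0, ∃ x, 0 < height x ∧ zeta Θ x < ε) : IsRegular Θ := by
  obtain ⟨x, hx⟩ := exists_isBestSeq (fun _ => hΘ.zeta_pos) hinf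
  refine ⟨x, hx, 0, fun ν _ x' hx' hh => ?_⟩
  exact hΘ.eq_or_eq_neg (height_pos_iff.1 (hx.isBest ν).1)
    (le_antisymm ((hx.isBest ν).2 x' hx'.1 hh.le) (hx'.2 _ (hx.isBest ν).1 hh.ge))

end

/-! ### A very singular pair of numbers -/

section

open Filter Topology

open scoped Nat

/-- The number `∑ i, c i / 2 ^ i!` with integer digits `c i`. -/
def lacunary (c : ℕ → ℤ) : ℝ := ∑' i, (c i : ℝ) / 2 ^ i !

lemma summable_lacunary {c : ℕ → ℤ} {B : ℤ} (hc : ∀ i, |c i| ≤ B) :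
    Summable fun i => (c i : ℝ) / 2 ^ i ! := by
  refine Summable.of_norm_bounded ((LiouvilleNumber.summable one_lt_two).mul_left (B : ℝ)) ?_
  intro i
  have : |(c i : ℝ)| ≤ B := by exact_mod_cast hc i
  rw [norm_div, Real.norm_eq_abs, norm_pow, Real.norm_two, mul_one_div]
  gcongr

lemma abs_lacunary_sub_le {c : ℕ → ℤ} {B : ℤ} (hc : ∀ i, |c i| ≤ B) (K : ℕ) :
    |lacunary c - ∑ i ∈ Finset.range (K + 1), (c i : ℝ) / 2 ^ i !| ≤ B * (2 / 2 ^ (K + 1)!) := by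
  have hs := summable_lacunary hc
  have hB : (0 : ℝ) ≤ B := by exact_mod_cast (abs_nonneg _).trans (hc 0)
  rw [lacunary, ← hs.sum_add_tsum_nat_add (K + 1), add_sub_cancel_left]
  have hr := LiouvilleNumber.remainder_summable (m := 2) one_lt_two K
  calc |∑' i, (c (i + (K + 1)) : ℝ) / 2 ^ (i + (K + 1))!|
      ≤ ∑' i, (B : ℝ) * (1 / 2 ^ (i + (K + 1))!) := by
        rw [← Real.norm_eq_abs]
        refine tsum_of_norm_bounded (hr.mul_left (B : ℝ)).hasSum fun i => ?_
        have : |(c (i + (K + 1)) : ℝ)| ≤ B := by exact_mod_cast hc _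
        rw [norm_div, Real.norm_eq_abs, norm_pow, Real.norm_two, mul_one_div]
        gcongr
    _ = B * LiouvilleNumber.remainder 2 K := by rw [tsum_mul_left, LiouvilleNumber.remainder]
    _ ≤ B * (2 / 2 ^ (K + 1)!) := by
        gcongr
        have := LiouvilleNumber.remainder_lt' K (m := 2) one_lt_two
        norm_num at this
        rw [div_eq_mul_inv]
        exact this.le

lemma exists_int_eq_partial_sum (c : ℕ → ℤ) (K : ℕ) :
    ∃ P : ℤ, (P : ℝ) = 2 ^ K ! * ∑ i ∈ Finset.range (K + 1), (c i : ℝ) / 2 ^ i ! := by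
  refine ⟨∑ i ∈ Finset.range (K + 1), c i * 2 ^ ((K !) - (i !)), ?_⟩
  push_cast
  rw [Finset.mul_sum]
  refine Finset.sum_congr rfl fun i hi => ?_
  have hi : i ! ≤ K ! := Nat.factorial_le (Nat.lt_succ_iff.1 (Finset.mem_range.1 hi))
  rw [pow_sub₀ _ two_ne_zero hi]
  field_simp

/-- A rational lacunary number with bounded digits has only finitely many nonzero digits. -/
lemma eventually_eq_zero_of_lacunary_eq_int {c : ℕ → ℤ} {B : ℤ} (hc : ∀ i, |c i| ≤ B) {r : ℤ}
    (h : lacunary c = r) : ∀ᶠ K in atTop, c K = 0 := by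
  have hB : (0 : ℝ) ≤ B := by exact_mod_cast (abs_nonneg _).trans (hc 0)
  have hsum : ∀ᶠ K : ℕ in atTop, ∑ i ∈ Finset.range (K + 1), (c i : ℝ) / 2 ^ i ! = r := by
    have hlarge : ∀ᶠ K : ℕ in atTop, (B : ℝ) * 2 < 2 ^ K :=
      (tendsto_pow_atTop_atTop_of_one_lt one_lt_two).eventually_gt_atTop _
    filter_upwards [hlarge] with K hK
    -- The difference is a multiple of `2 ^ (-K!)` and smaller than that in absolute value.
    obtain ⟨P, hP⟩ := exists_int_eq_partial_sum c K
    have h1 := abs_lacunary_sub_le hc K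
    rw [h] at h1
    have hpos : (0 : ℝ) < 2 ^ K ! := by positivity
    have hfac : (2 : ℝ) ^ K ! * 2 ^ K ≤ 2 ^ (K + 1)! := by
      rw [← pow_add]
      refine pow_le_pow_right₀ one_le_two ?_
      rw [Nat.factorial_succ]
      nlinarith [Nat.factorial_pos K]
    have h2 : |((2 ^ K ! * r - P : ℤ) : ℝ)| < 1 := by
      push_cast
      rw [hP, ← mul_sub, abs_mul, abs_of_pos hpos]
      calc _ ≤ (2 : ℝ) ^ K ! * (B * (2 / 2 ^ (K + 1)!)) := by gcongr
        _ = (2 ^ K ! * (B * 2)) / 2 ^ (K + 1)! := by ring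
        _ < 1 := by
          rw [div_lt_one (by positivity)]
          exact (mul_lt_mul_of_pos_left hK hpos).trans_le hfac
    have h3 : (2 : ℤ) ^ K ! * r - P = 0 := by
      rw [← Int.abs_lt_one_iff]
      exact_mod_cast h2
    have h4 : (2 : ℝ) ^ K ! * r = P := by exact_mod_cast sub_eq_zero.1 h3
    rw [hP] at h4
    exact (mul_left_cancel₀ hpos.ne' h4).symm
  have hboth := hsum.and ((tendsto_add_atTop_nat 1).eventually hsum)
  rw [← map_add_atTop_eq_nat 1, eventually_map]
  filter_upwards [hboth] with K hK
  have h2 := hK.2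
  rw [Finset.sum_range_succ, hK.1] at h2
  have h3 : (c (K + 1) : ℝ) / 2 ^ (K + 1)! = 0 := by linarith
  have h4 : (2 : ℝ) ^ (K + 1)! ≠ 0 := by positivity
  exact_mod_cast (div_eq_zero_iff.1 h3).resolve_right h4

/-- Digits `0` and `1`, the digit `0` at `K + 1`: truncating after `K` gives a rational
approximation with denominator `2 ^ K!` whose error is of the size of `2 ^ (-(K + 2)!)`. -/
lemma exists_int_abs_lacunary_le {c : ℕ → ℤ} (hc0 : ∀ i, 0 ≤ c i) (hc1 : ∀ i, c i ≤ 1)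
    (h01 : c 0 + c 1 ≤ 1) {K : ℕ} (hK : c (K + 1) = 0) :
    ∃ r : ℤ, |r| ≤ 2 ^ K ! ∧ |2 ^ K ! * lacunary c + r| ≤ 2 ^ K ! * (2 / 2 ^ (K + 2)!) := by
  have hc : ∀ i, |c i| ≤ 1 := fun i => abs_le.2 ⟨by linarith [hc0 i], hc1 i⟩
  have hpos : (0 : ℝ) < 2 ^ K ! := by positivity
  obtain ⟨P, hP⟩ := exists_int_eq_partial_sum c K
  have hnn : ∀ i, 0 ≤ (c i : ℝ) / 2 ^ i ! := fun i => by
    have : (0 : ℝ) ≤ c i := by exact_mod_cast hc0 i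
    positivity
  have hle1 : lacunary c ≤ 1 := by
    have h1 := (abs_le.1 (abs_lacunary_sub_le hc 1)).2
    have h2 : (c 0 : ℝ) + c 1 ≤ 1 := by exact_mod_cast h01
    norm_num [Finset.sum_range_succ, Nat.factorial] at h1
    linarith
  have hpart : ∑ i ∈ Finset.range (K + 1), (c i : ℝ) / 2 ^ i ! ≤ 1 :=
    ((summable_lacunary hc).sum_le_tsum _ fun i _ => hnn i).trans hle1
  refine ⟨-P, ?_, ?_⟩
  · have : |(P : ℝ)| ≤ 2 ^ K ! := by
      rw [hP, abs_of_nonneg (mul_nonneg hpos.le (Finset.sum_nonneg fun i _ => hnn i))]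
      nlinarith
    rw [abs_neg]
    exact_mod_cast this
  · have h1 := abs_lacunary_sub_le hc (K + 1)
    rw [Finset.sum_range_succ, hK] at h1
    push_cast
    rw [hP, ← sub_eq_add_neg, ← mul_sub, abs_mul, abs_of_pos hpos]
    gcongr
    simpa using h1

lemma exists_factorial_bracket (K₀ : ℕ) :
    ∀ᶠ X : ℕ in atTop, ∃ K ≥ K₀, 2 ^ K ! ≤ X ∧ X < 2 ^ (K + 1)! := by
  filter_upwards [eventually_ge_atTop (2 ^ K₀ !)] with X hX
  have hex : ∃ K, K₀ ≤ K ∧ X < 2 ^ (K + 1)! :=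
    ⟨max K₀ X, le_max_left _ _, Nat.lt_two_pow_self.trans_le
      (Nat.pow_le_pow_right two_pos ((le_max_right K₀ X).trans
        ((Nat.le_succ _).trans (Nat.self_le_factorial _))))⟩
  classical
  obtain ⟨h1, h2⟩ := Nat.find_spec hex
  refine ⟨Nat.find hex, h1, ?_, h2⟩
  rcases h1.eq_or_lt with h | h
  · rwa [← h]
  · by_contra! h3
    obtain ⟨K, hK⟩ : ∃ K, Nat.find hex = K + 1 := ⟨Nat.find hex - 1, by omega⟩
    rw [hK] at h3 h
    exact Nat.find_min hex (m := K) (by omega) ⟨by omega, h3⟩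

/-- A pair of numbers that is singular to every polynomial order: the linear form `p a + q b + r`
vanishes only trivially, but takes extremely small values below every large height. The truncations
of the two lacunary series, used alternately, give these values: the truncation of one series is
good because the digits of the other occupy the next place. -/
theorem exists_singular_pair : ∃ a b : ℝ,
    (∀ p q r : ℤ, (p : ℝ) * a + q * b + r = 0 → p = 0 ∧ q = 0 ∧ r = 0) ∧
    ∀ N : ℕ, ∀ᶠ X : ℕ in atTop, ∃ p q r : ℤ, (p ≠ 0 ∨ q ≠ 0) ∧ |p| ≤ X ∧ |q| ≤ X ∧ |r| ≤ X ∧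
      |(p : ℝ) * a + q * b + r| * (2 * X + 1) ^ N < 1 / 2 := by
  set e : ℕ → ℤ := fun i => if Even i then 1 else 0 with he
  set o : ℕ → ℤ := fun i => if Even i then 0 else 1 with ho
  have he0 : ∀ i, 0 ≤ e i := fun i => by simp only [he]; split_ifs <;> simp
  have he1 : ∀ i, e i ≤ 1 := fun i => by simp only [he]; split_ifs <;> simp
  have ho0 : ∀ i, 0 ≤ o i := fun i => by simp only [ho]; split_ifs <;> simp
  have ho1 : ∀ i, o i ≤ 1 := fun i => by simp only [ho]; split_ifs <;> simp
  have hea : ∀ i, |e i| ≤ 1 := fun i => abs_le.2 ⟨by linarith [he0 i], he1 i⟩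
  have hoa : ∀ i, |o i| ≤ 1 := fun i => abs_le.2 ⟨by linarith [ho0 i], ho1 i⟩
  refine ⟨lacunary e, lacunary o, ?_, ?_⟩
  · intro p q r h
    have hcomb : lacunary (fun i => p * e i + q * o i) = ((-r : ℤ) : ℝ) := by
      have : lacunary (fun i => p * e i + q * o i) = p * lacunary e + q * lacunary o := by
        rw [lacunary, lacunary, lacunary, ← tsum_mul_left, ← tsum_mul_left,
          ← ((summable_lacunary hea).mul_left _).tsum_add ((summable_lacunary hoa).mul_left _)]
        refine tsum_congr fun i => ?_
        push_cast
        ring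
      rw [this]
      push_cast
      linarith
    have hbd : ∀ i, |p * e i + q * o i| ≤ |p| + |q| := fun i => by
      refine (abs_add_le _ _).trans ?_
      rw [abs_mul, abs_mul]
      have := mul_le_mul_of_nonneg_left (hea i) (abs_nonneg p)
      have := mul_le_mul_of_nonneg_left (hoa i) (abs_nonneg q)
      linarith
    obtain ⟨K, hK⟩ := eventually_atTop.1 (eventually_eq_zero_of_lacunary_eq_int hbd hcomb)
    have hp : p = 0 := by simpa [he, ho] using hK (2 * K) (by omega)
    have hq : q = 0 := by
      have := hK (2 * K + 1) (by omega)
      have hodd : ¬ Even (2 * K + 1) := by simp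
      simpa [he, ho, hodd] using this
    subst hp hq
    simp only [Int.cast_zero, zero_mul, zero_add, Int.cast_eq_zero] at h
    exact ⟨rfl, rfl, h⟩
  · intro N
    filter_upwards [exists_factorial_bracket (2 * N + 2)] with X hX
    obtain ⟨K, hKN, hKX, hXK⟩ := hX
    have hsmall : ∀ t : ℝ, |t| ≤ 2 ^ K ! * (2 / 2 ^ (K + 2)!) →
        |t| * (2 * X + 1) ^ N < 1 / 2 := by
      intro t ht
      have hX1 : (2 * X + 1 : ℝ) ≤ 2 ^ ((K + 1)! + 1) := by
        have : 2 * X + 1 ≤ 2 ^ ((K + 1)! + 1) := by rw [pow_succ]; omega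
        exact_mod_cast this
      have hexp : K ! + 3 + ((K + 1)! + 1) * N ≤ (K + 2)! := by
        have h1 : 1 ≤ (K + 1)! := Nat.factorial_pos _
        have h2 : K ! ≤ (K + 1)! := Nat.factorial_le (Nat.le_succ K)
        rw [Nat.factorial_succ (K + 1)]
        nlinarith [Nat.mul_le_mul_right (K + 1)! hKN, Nat.mul_le_mul_right N h1]
      have hpow : (2 : ℝ) ^ (K ! + 3 + ((K + 1)! + 1) * N) ≤ 2 ^ (K + 2)! :=
        pow_le_pow_right₀ one_le_two hexp
      calc |t| * (2 * X + 1) ^ N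
          ≤ 2 ^ K ! * (2 / 2 ^ (K + 2)!) * (2 ^ ((K + 1)! + 1)) ^ N := by gcongr
        _ = (1 / 4) * (2 ^ (K ! + 3 + ((K + 1)! + 1) * N) / 2 ^ (K + 2)!) := by
            rw [← pow_mul, pow_add, pow_add]; ring
        _ ≤ (1 / 4) * 1 := by
            gcongr
            exact (div_le_one (by positivity)).2 hpow
        _ < 1 / 2 := by norm_num
    have hKX' : (2 : ℤ) ^ K ! ≤ X := by exact_mod_cast hKX
    by_cases hK : Even K
    · have hK1 : ¬ Even (K + 1) := by simpa [Nat.even_add_one] using hK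
      obtain ⟨r, hr, hrs⟩ := exists_int_abs_lacunary_le he0 he1 (by simp [he]) (K := K)
        (by simp [he, hK1])
      refine ⟨2 ^ K !, 0, r, Or.inl (by positivity), by simpa using hKX', by simp,
        hr.trans hKX', hsmall _ ?_⟩
      simpa using hrs
    · have hK1 : Even (K + 1) := by simpa [Nat.even_add_one] using hK
      obtain ⟨r, hr, hrs⟩ := exists_int_abs_lacunary_le ho0 ho1 (by simp [ho]) (K := K)
        (by simp [ho, hK1])
      refine ⟨0, 2 ^ K !, r, Or.inr (by positivity), by simp, by simpa using hKX',
        hr.trans hKX', hsmall _ ?_⟩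
      simpa using hrs

end

/-! ### Generic parameters -/

section

open Filter Topology MeasureTheory

open scoped ENNReal

/-- Lebesgue measure on `[1, 2]`, a probability measure. -/
def measureIcc : Measure ℝ := volume.restrict (Set.Icc 1 2)

instance : IsProbabilityMeasure measureIcc := ⟨by simp [measureIcc]; norm_num⟩

/-- A measurable set whose sections in direction `p` have measure at most `δ` has measure at
most `δ`. -/
lemma measure_pi_le_of_sections {ι : Type*} [Fintype ι] [DecidableEq ι] {S : Set (ι → ℝ)}
    (hS : MeasurableSet S) (p : ι) {δ : ℝ≥0∞}
    (h : ∀ β : ι → ℝ, measureIcc {c | Function.update β p c ∈ S} ≤ δ) :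
    Measure.pi (fun _ : ι => measureIcc) S ≤ δ := by
  rw [← lintegral_indicator_one hS]
  refine (lintegral_le_of_lmarginal_le {p} (g := fun _ => δ)
    (measurable_one.indicator hS) measurable_const ?_).trans_eq (by simp)
  rw [lmarginal_singleton, lmarginal_singleton]
  intro β
  have hm : MeasurableSet {c | Function.update β p c ∈ S} := measurable_update β hS
  calc ∫⁻ c, S.indicator 1 (Function.update β p c) ∂measureIcc
      = ∫⁻ c, ({c | Function.update β p c ∈ S}).indicator 1 c ∂measureIcc := rfl
    _ = measureIcc {c | Function.update β p c ∈ S} := lintegral_indicator_one hm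
    _ ≤ δ := h β
    _ = ∫⁻ _, δ ∂measureIcc := by simp

lemma measurable_distInt : Measurable distInt := by
  have : distInt = fun t : ℝ => |t - (⌊t + 1 / 2⌋ : ℤ)| := by
    ext t
    rw [distInt, round_eq]
  rw [this]
  have h1 : Measurable fun t : ℝ => ((⌊t + 1 / 2⌋ : ℤ) : ℝ) :=
    (measurable_from_top (f := fun z : ℤ => (z : ℝ))).comp
      (Int.measurable_floor.comp (measurable_id.add_const _))
  exact (measurable_id.sub h1).abs

/-- If the slope `t` is not small, then `s + c t` is `ε`-close to an integer only for a set of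
`c ∈ [1, 2]` of measure `O(ε)`: there are at most `|t| + 2` intervals, each of length
`2 ε / |t|`. -/
lemma measureIcc_distInt_lt_le (s : ℝ) {t ε : ℝ} (ht : 1 / 4 ≤ |t|) (hε : 0 ≤ ε) :
    measureIcc {c | distInt (s + c * t) < ε} ≤ ENNReal.ofReal (18 * ε) := by
  have ht0 : 0 < |t| := by linarith
  have htne : t ≠ 0 := abs_pos.1 ht0
  set u := s + 3 / 2 * t
  set w := |t| / 2 + 1 / 2
  have hsub : {c | distInt (s + c * t) < ε} ∩ Set.Icc 1 2 ⊆
      ⋃ z ∈ Finset.Icc ⌈u - w⌉ ⌊u + w⌋, Metric.ball (((z : ℝ) - s) / t) (ε / |t|) := by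
    rintro c ⟨hc, hc1, hc2⟩
    have hr := abs_sub_round (s + c * t)
    have h1 : |(c - 3 / 2) * t| ≤ |t| / 2 := by
      rw [abs_mul]
      have : |c - 3 / 2| ≤ 1 / 2 := abs_le.2 ⟨by linarith, by linarith⟩
      nlinarith
    rw [abs_le] at hr h1
    simp only [Set.mem_iUnion, Finset.mem_Icc]
    refine ⟨round (s + c * t), ⟨Int.ceil_le.2 ?_, Int.le_floor.2 ?_⟩, ?_⟩
    · simp only [u, w]; linarith
    · simp only [u, w]; linarith
    · rw [Metric.mem_ball, Real.dist_eq, lt_div_iff₀ ht0, ← abs_mul, sub_mul, div_mul_cancel₀ _ htne]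
      have : c * t - (round (s + c * t) - s) = s + c * t - round (s + c * t) := by ring
      rw [this]
      exact hc
  have hmeas : MeasurableSet {c : ℝ | distInt (s + c * t) < ε} :=
    measurableSet_lt (measurable_distInt.comp (f := fun c : ℝ => s + c * t) (by fun_prop))
      measurable_const
  rw [measureIcc, Measure.restrict_apply hmeas]
  refine (measure_mono hsub).trans ((measure_biUnion_finset_le _ _).trans ?_)
  simp only [Real.volume_ball, Finset.sum_const, nsmul_eq_mul]
  rw [← ENNReal.ofReal_natCast, ← ENNReal.ofReal_mul (by positivity)]
  refine ENNReal.ofReal_le_ofReal ?_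
  have hcard : ((Finset.Icc ⌈u - w⌉ ⌊u + w⌋).card : ℝ) ≤ |t| + 2 := by
    rw [Int.card_Icc]
    have h1 := Int.floor_le (u + w)
    have h2 := Int.le_ceil (u - w)
    have h3 : (((⌊u + w⌋ + 1 - ⌈u - w⌉).toNat : ℤ) : ℝ) = max (⌊u + w⌋ + 1 - ⌈u - w⌉ : ℝ) 0 := by
      rw [Int.toNat_eq_max]; push_cast; rfl
    rw [Int.cast_natCast] at h3
    rw [h3]
    refine max_le ?_ (by positivity)
    simp only [w] at h1 h2 ⊢
    linarith
  calc ((Finset.Icc ⌈u - w⌉ ⌊u + w⌋).card : ℝ) * (2 * (ε / |t|))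
      ≤ (|t| + 2) * (2 * (ε / |t|)) := by gcongr
    _ = 2 * ε + 4 * (ε / |t|) := by field_simp; ring
    _ ≤ 2 * ε + 4 * (4 * ε) := by
        gcongr
        rw [div_le_iff₀ ht0]
        nlinarith
    _ = 18 * ε := by ring

lemma sum_update_mul {ι : Type*} [Fintype ι] [DecidableEq ι] (β t : ι → ℝ) (p : ι) (c : ℝ) :
    ∑ q, Function.update β p c q * t q = (∑ q, β q * t q - β p * t p) + c * t p := by
  rw [Fintype.sum_eq_add_sum_compl p, Fintype.sum_eq_add_sum_compl p (fun q => β q * t q)]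
  have : ∀ q ∈ ({p} : Finset ι)ᶜ, Function.update β p c q * t q = β q * t q := by
    intro q hq
    rw [Function.update_of_ne (by simpa using hq)]
  rw [Finset.sum_congr rfl this, Function.update_self]
  ring

/-- An affine form with a coefficient of absolute value at least `1 / 4` is rarely close to an
integer. -/
lemma measure_pi_distInt_lt_le {ι : Type*} [Fintype ι] [DecidableEq ι] {t : ι → ℝ} {p : ι} {ε : ℝ}
    (ht : 1 / 4 ≤ |t p|) (hε : 0 ≤ ε) :
    Measure.pi (fun _ : ι => measureIcc) {β | distInt (∑ q, β q * t q) < ε} ≤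
      ENNReal.ofReal (18 * ε) := by
  refine measure_pi_le_of_sections
    (measurableSet_lt (measurable_distInt.comp (f := fun β : ι → ℝ => ∑ q, β q * t q)
      (by fun_prop)) measurable_const) p fun β => ?_
  simp only [Set.mem_ofPred_eq, Function.comp_apply, sum_update_mul]
  exact measureIcc_distInt_lt_le _ ht hε

/-- A nonconstant affine form vanishes almost nowhere. -/
lemma ae_affine_ne_zero {ι : Type*} [Fintype ι] [DecidableEq ι] {t : ι → ℝ} {p : ι} (r : ℝ)
    (ht : t p ≠ 0) :
    ∀ᵐ β ∂Measure.pi (fun _ : ι => measureIcc), r + ∑ q, β q * t q ≠ 0 := by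
  rw [ae_iff, ← nonpos_iff_eq_zero]
  simp only [not_not]
  refine measure_pi_le_of_sections
    (measurableSet_eq_fun (by fun_prop) measurable_const) p fun β => ?_
  simp only [Set.mem_ofPred_eq, sum_update_mul]
  have hsub : {c | r + (∑ q, β q * t q - β p * t p + c * t p) = 0} ⊆
      {-(r + (∑ q, β q * t q - β p * t p)) / t p} := by
    intro c hc
    rw [Set.mem_ofPred_eq] at hc
    rw [Set.mem_singleton_iff, eq_div_iff ht]
    linarith
  refine (measure_mono hsub).trans ?_
  rw [measureIcc]
  exact (Measure.restrict_le_self _).trans (by simp)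

variable {n k : ℕ}

/-- The `k + 1` real numbers through which all the linear forms of `paramMatrix` factor: the
combination `x₀ a + x₁ b + x₂`, and the remaining coordinates. -/
def reduced (a b : ℝ) (x : Fin (k + 3) → ℤ) : Fin (k + 1) → ℝ :=
  Fin.cons (x 0 * a + x 1 * b + x 2) fun i => (x i.succ.succ.succ : ℝ)

/-- The matrix with rows `(a β_j0, b β_j0, β_j0, β_j1, …, β_jk)`. -/
def paramMatrix (a b : ℝ) (β : Fin n × Fin (k + 1) → ℝ) : Matrix (Fin n) (Fin (k + 3)) ℝ :=
  fun j => Fin.cons (a * β (j, 0)) (Fin.cons (b * β (j, 0)) fun i : Fin (k + 1) => β (j, i))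

lemma linForm_paramMatrix (a b : ℝ) (β : Fin n × Fin (k + 1) → ℝ) (x : Fin (k + 3) → ℤ)
    (j : Fin n) :
    linForm (paramMatrix a b β) x j = ∑ i, β (j, i) * reduced a b x i := by
  rw [linForm, Fin.sum_univ_succ, Fin.sum_univ_succ, Fin.sum_univ_succ,
    Fin.sum_univ_succ (n := k)]
  simp only [paramMatrix, reduced, Fin.cons_zero, Fin.cons_succ]
  simp only [Fin.succ_zero_eq_one, Fin.succ_one_eq_two]
  ring

lemma reduced_eq_zero {a b : ℝ}
    (hab : ∀ p q r : ℤ, (p : ℝ) * a + q * b + r = 0 → p = 0 ∧ q = 0 ∧ r = 0)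
    {x : Fin (k + 3) → ℤ} (h : reduced a b x = 0) : x = 0 := by
  have h0 := hab _ _ _ (congr_fun h 0)
  ext i
  refine Fin.cases h0.1 (fun i => Fin.cases h0.2.1 (fun i => Fin.cases h0.2.2 (fun i => ?_) i) i) i
  have := congr_fun h i.succ
  simpa [reduced] using this

lemma ae_entriesIndep {a b : ℝ}
    (hab : ∀ p q r : ℤ, (p : ℝ) * a + q * b + r = 0 → p = 0 ∧ q = 0 ∧ r = 0) :
    ∀ᵐ β ∂Measure.pi (fun _ : Fin n × Fin (k + 1) => measureIcc),
      EntriesIndep (paramMatrix a b β) := by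
  simp only [entriesIndep_iff]
  rw [ae_all_iff]
  intro r
  rw [ae_all_iff]
  intro A
  by_cases hA : A = 0
  · subst hA
    refine Eventually.of_forall fun β hβ => ⟨?_, rfl⟩
    simpa [linForm] using hβ
  · obtain ⟨j, hj⟩ := Function.ne_iff.1 hA
    obtain ⟨i, hi⟩ := Function.ne_iff.1 fun h => hj (reduced_eq_zero hab h)
    filter_upwards [ae_affine_ne_zero (t := fun p : Fin n × Fin (k + 1) =>
      reduced a b (A p.1) p.2) (p := (j, i)) r hi] with β hβ h
    refine absurd ?_ hβ
    rw [Fintype.sum_prod_type]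
    simpa only [linForm_paramMatrix] using h

/-- Borel–Cantelli: almost surely, at every large height `h`, the vectors of height at most `h` with
a reduced entry that is not small have `‖L_j(x)‖` at least a fixed negative power of `h`. The
exponent `k + 5` beats the `(2 h + 1) ^ (k + 3)` vectors of height at most `h` by `2`. -/
lemma ae_eventually_le_distInt (a b : ℝ) (j : Fin n) :
    ∀ᵐ β ∂Measure.pi (fun _ : Fin n × Fin (k + 1) => measureIcc),
      ∀ᶠ h : ℕ in atTop, ∀ x, height x ≤ h → (∃ i, 1 / 4 ≤ |reduced a b x i|) →
        1 / (2 * h + 1 : ℝ) ^ (k + 5) ≤ distInt (linForm (paramMatrix a b β) x j) := by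
  set μ := Measure.pi (fun _ : Fin n × Fin (k + 1) => measureIcc)
  set bad : ℕ → (Fin (k + 3) → ℤ) → Set (Fin n × Fin (k + 1) → ℝ) := fun h x =>
    {β | (∃ i, 1 / 4 ≤ |reduced a b x i|) ∧
      distInt (linForm (paramMatrix a b β) x j) < 1 / (2 * h + 1 : ℝ) ^ (k + 5)} with hbad
  have hx : ∀ h x, μ (bad h x) ≤ ENNReal.ofReal (18 * (1 / (2 * h + 1 : ℝ) ^ (k + 5))) := by
    intro h x
    by_cases hi : ∃ i, 1 / 4 ≤ |reduced a b x i|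
    · obtain ⟨i, hi⟩ := hi
      refine (measure_mono ?_).trans (measure_pi_distInt_lt_le (ι := Fin n × Fin (k + 1))
        (t := fun p => if p.1 = j then reduced a b x p.2 else 0) (p := (j, i))
        (by simpa using hi) (by positivity))
      rintro β ⟨-, hβ⟩
      rw [linForm_paramMatrix] at hβ
      rw [Set.mem_ofPred_eq, Fintype.sum_prod_type]
      simpa [mul_ite, Finset.sum_ite_irrel] using hβ
    · have : bad h x = ∅ := Set.eq_empty_of_forall_notMem fun β hβ => hi hβ.1
      simp [this]
  have hsum : ∑' h : ℕ, μ (⋃ x ∈ Fintype.piFinset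
      (fun _ : Fin (k + 3) => Finset.Icc (-(h : ℤ)) h), bad h x) ≠ ∞ := by
    have hs : Summable fun h : ℕ => 18 * (1 / ((h : ℝ) + 1) ^ 2) := by
      have := (summable_nat_add_iff 1).2 (Real.summable_one_div_nat_pow.2 one_lt_two)
      simpa using this.mul_left 18
    refine ne_top_of_le_ne_top hs.tsum_ofReal_ne_top (ENNReal.tsum_le_tsum fun h => ?_)
    refine (measure_biUnion_finset_le _ _).trans ((Finset.sum_le_sum fun x _ => hx h x).trans ?_)
    rw [Finset.sum_const, nsmul_eq_mul, Fintype.card_piFinset_const, Int.card_Icc,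
      ← ENNReal.ofReal_natCast, ← ENNReal.ofReal_mul (by positivity)]
    refine ENNReal.ofReal_le_ofReal ?_
    have hcard : ((h : ℤ) + 1 - -(h : ℤ)).toNat = 2 * h + 1 := by omega
    rw [hcard]
    push_cast
    calc (2 * h + 1 : ℝ) ^ (k + 3) * (18 * (1 / (2 * h + 1) ^ (k + 5)))
        = 18 * (1 / (2 * h + 1) ^ 2) := by
          rw [show k + 5 = (k + 3) + 2 by ring, pow_add _ (k + 3) 2]
          have : (2 * h + 1 : ℝ) ^ (k + 3) ≠ 0 := by positivity
          generalize (2 * h + 1 : ℝ) ^ (k + 3) = y at *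
          field_simp
      _ ≤ 18 * (1 / ((h : ℝ) + 1) ^ 2) := by
          gcongr
          linarith [(Nat.cast_nonneg h : (0 : ℝ) ≤ h)]
  filter_upwards [ae_eventually_notMem hsum] with β hβ
  filter_upwards [hβ] with h hh x hxh hi
  by_contra! hlt
  refine hh ?_
  simp only [Set.mem_iUnion]
  exact ⟨x, mem_piFinset_Icc_iff.2 hxh, hi, hlt⟩

lemma ae_mem_Icc {ι : Type*} [Fintype ι] [DecidableEq ι] :
    ∀ᵐ β ∂Measure.pi (fun _ : ι => measureIcc), ∀ p, β p ∈ Set.Icc (1 : ℝ) 2 := by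
  rw [ae_all_iff]
  intro p
  rw [ae_iff, ← nonpos_iff_eq_zero]
  refine measure_pi_le_of_sections (p := p)
    ((measurable_pi_apply p) measurableSet_Icc.compl) fun β => ?_
  change measureIcc {c | Function.update β p c p ∉ Set.Icc (1 : ℝ) 2} ≤ 0
  simp only [Function.update_self]
  exact (mem_ae_iff.1 (ae_restrict_mem measurableSet_Icc)).le

theorem exists_generic_param [NeZero n] {a b : ℝ}
    (hab : ∀ p q r : ℤ, (p : ℝ) * a + q * b + r = 0 → p = 0 ∧ q = 0 ∧ r = 0) :
    ∃ β : Fin n × Fin (k + 1) → ℝ, (∀ p, β p ∈ Set.Icc (1 : ℝ) 2) ∧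
      EntriesIndep (paramMatrix a b β) ∧
      ∀ᶠ h : ℕ in atTop, ∀ x, height x ≤ h → (∃ i, 1 / 4 ≤ |reduced a b x i|) →
        1 / (2 * h + 1 : ℝ) ^ (k + 5) ≤ zeta (paramMatrix a b β) x := by
  obtain ⟨β, h1, h2, h3⟩ := ((ae_mem_Icc (ι := Fin n × Fin (k + 1))).and ((ae_entriesIndep hab).and
    (ae_eventually_le_distInt a b (0 : Fin n)))).exists
  refine ⟨β, h1, h2, ?_⟩
  filter_upwards [h3] with h hh x hx hi
  exact (hh x hx hi).trans (distInt_linForm_le_zeta _ _ _)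

end

/-! ### The leading coordinate subspace -/

section

open Filter Topology

variable {n k : ℕ}

/-- The subspace of `ℝ^(m+n)` spanned by the first three coordinate vectors. -/
def leadingSubspace (n k : ℕ) : Submodule ℝ (Fin (k + 3) ⊕ Fin n → ℝ) :=
  Submodule.span ℝ (Set.range fun i : Fin 3 =>
    Pi.single (Sum.inl (Fin.castLE (Nat.le_add_left 3 k) i)) 1)

lemma finrank_leadingSubspace : Module.finrank ℝ (leadingSubspace n k) = 3 := by
  have hli : LinearIndependent ℝ fun i : Fin 3 =>
      (Pi.single (Sum.inl (Fin.castLE (Nat.le_add_left 3 k) i)) 1 :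
        Fin (k + 3) ⊕ Fin n → ℝ) := by
    have := (Pi.basisFun ℝ (Fin (k + 3) ⊕ Fin n)).linearIndependent.comp
      (fun i : Fin 3 => Sum.inl (Fin.castLE (Nat.le_add_left 3 k) i))
      (Sum.inl_injective.comp (Fin.castLE_injective _))
    simpa [Function.comp_def] using this
  rw [leadingSubspace, finrank_span_eq_card hli, Fintype.card_fin]

lemma mem_leadingSubspace {v : Fin (k + 3) ⊕ Fin n → ℝ}
    (hl : ∀ i : Fin k, v (Sum.inl i.succ.succ.succ) = 0) (hr : ∀ j, v (Sum.inr j) = 0) :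
    v ∈ leadingSubspace n k := by
  have hv : v = ∑ i : Fin 3, v (Sum.inl (Fin.castLE (Nat.le_add_left 3 k) i)) •
      (Pi.single (Sum.inl (Fin.castLE (Nat.le_add_left 3 k) i)) 1 :
        Fin (k + 3) ⊕ Fin n → ℝ) := by
    ext q
    rw [Finset.sum_apply]
    simp only [Pi.smul_apply, smul_eq_mul, Pi.single_apply, mul_ite, mul_one, mul_zero]
    rcases q with i | j
    · by_cases hi : i.1 < 3
      · rw [Finset.sum_eq_single (⟨i.1, hi⟩ : Fin 3)]
        · simp
        · intro i' _ hne
          rw [if_neg]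
          simp only [Sum.inl.injEq, Fin.ext_iff, Fin.val_castLE]
          exact fun h => hne (Fin.ext h.symm)
        · simp
      · have : i = (⟨i.1 - 3, by omega⟩ : Fin k).succ.succ.succ := by
          ext; simp; omega
        rw [this, hl, Finset.sum_eq_zero]
        intro i' _
        rw [if_neg]
        simp only [Sum.inl.injEq, Fin.ext_iff, Fin.val_succ, Fin.val_castLE]
        omega
    · simp [hr]
  rw [hv]
  exact Submodule.sum_mem _ fun i _ => Submodule.smul_mem _ _ (Submodule.subset_span ⟨i, rfl⟩)

/-- The integer points of `leadingSubspace`. -/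
def leadingLattice (n k : ℕ) : AddSubgroup (Fin (k + 3) ⊕ Fin n → ℤ) where
  carrier := {z | toReal z ∈ leadingSubspace n k}
  zero_mem' := by
    have : toReal (0 : Fin (k + 3) ⊕ Fin n → ℤ) = 0 := by ext; simp [toReal]
    simp [this]
  add_mem' {z w} hz hw := by
    have : toReal (z + w) = toReal z + toReal w := by ext; simp [toReal]
    simpa [this] using Submodule.add_mem _ hz hw
  neg_mem' {z} hz := by
    have : toReal (-z) = -toReal z := by ext; simp [toReal]
    simpa [this] using hz

lemma latticeDim_leadingLattice : latticeDim (leadingLattice n k) = 3 := by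
  have : Submodule.span ℝ (toReal '' (leadingLattice n k : Set (Fin (k + 3) ⊕ Fin n → ℤ))) =
      leadingSubspace n k := by
    apply le_antisymm
    · rw [Submodule.span_le]
      rintro _ ⟨z, hz, rfl⟩
      exact hz
    · rw [leadingSubspace, Submodule.span_le]
      rintro _ ⟨i, rfl⟩
      have h : (Pi.single (Sum.inl (Fin.castLE (Nat.le_add_left 3 k) i)) 1 :
          Fin (k + 3) ⊕ Fin n → ℝ) =
          toReal (Pi.single (Sum.inl (Fin.castLE (Nat.le_add_left 3 k) i)) 1) := by
        ext q
        simp only [toReal, Pi.single_apply]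
        split_ifs <;> simp
      refine Submodule.subset_span ⟨_, ?_, h.symm⟩
      change toReal _ ∈ leadingSubspace n k
      rw [← h]
      exact Submodule.subset_span ⟨i, rfl⟩
  rw [latticeDim, this, finrank_leadingSubspace]

/-- All entries of the reduced vector are small. Such vectors are the integer vectors supported on the
first three coordinates with `|x₀ a + x₁ b + x₂| < 1 / 4`. -/
def IsReducedSmall (a b : ℝ) (x : Fin (k + 3) → ℤ) : Prop := ∀ i, |reduced a b x i| < 1 / 4

lemma IsReducedSmall.apply_eq_zero {a b : ℝ} {x : Fin (k + 3) → ℤ} (hx : IsReducedSmall a b x)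
    (i : Fin k) : x i.succ.succ.succ = 0 := by
  have h : |(x i.succ.succ.succ : ℝ)| < 1 / 4 := by simpa [reduced] using hx i.succ
  rw [← Int.abs_lt_one_iff]
  have : |(x i.succ.succ.succ : ℝ)| < 1 := by linarith
  exact_mod_cast this

lemma IsReducedSmall.linForm_eq {a b : ℝ} {x : Fin (k + 3) → ℤ} (hx : IsReducedSmall a b x)
    (β : Fin n × Fin (k + 1) → ℝ) (j : Fin n) :
    linForm (paramMatrix a b β) x j = β (j, 0) * reduced a b x 0 := by
  rw [linForm_paramMatrix, Fin.sum_univ_succ]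
  simp [reduced, hx.apply_eq_zero]

lemma IsReducedSmall.abs_linForm_lt {a b : ℝ} {x : Fin (k + 3) → ℤ} (hx : IsReducedSmall a b x)
    {β : Fin n × Fin (k + 1) → ℝ} (hβ : ∀ p, β p ∈ Set.Icc (1 : ℝ) 2) (j : Fin n) :
    |linForm (paramMatrix a b β) x j| < 1 / 2 := by
  rw [hx.linForm_eq, abs_mul, abs_of_nonneg (by linarith [(hβ (j, 0)).1])]
  nlinarith [hx 0, (hβ (j, 0)).2, abs_nonneg (reduced a b x 0)]

lemma IsReducedSmall.distInt_eq {a b : ℝ} {x : Fin (k + 3) → ℤ} (hx : IsReducedSmall a b x)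
    {β : Fin n × Fin (k + 1) → ℝ} (hβ : ∀ p, β p ∈ Set.Icc (1 : ℝ) 2) (j : Fin n) :
    distInt (linForm (paramMatrix a b β) x j) = β (j, 0) * |reduced a b x 0| := by
  rw [distInt_eq_abs (hx.abs_linForm_lt hβ j), hx.linForm_eq, abs_mul,
    abs_of_nonneg (by linarith [(hβ (j, 0)).1])]

lemma IsReducedSmall.toReal_extVec_mem {a b : ℝ} {x : Fin (k + 3) → ℤ} (hx : IsReducedSmall a b x)
    {β : Fin n × Fin (k + 1) → ℝ} (hβ : ∀ p, β p ∈ Set.Icc (1 : ℝ) 2) :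
    toReal (extVec (paramMatrix a b β) x) ∈ leadingSubspace n k := by
  refine mem_leadingSubspace (fun i => ?_) fun j => ?_
  · simp [toReal, extVec, hx.apply_eq_zero]
  · simp [toReal, extVec, round_eq_zero_of_abs_lt (hx.abs_linForm_lt hβ j)]

/-- On vectors with small reduction `ζ` is a fixed multiple of `|x₀ a + x₁ b + x₂|`. -/
lemma IsReducedSmall.zeta_eq {a b : ℝ} {x : Fin (k + 3) → ℤ} (hx : IsReducedSmall a b x)
    {β : Fin n × Fin (k + 1) → ℝ} (hβ : ∀ p, β p ∈ Set.Icc (1 : ℝ) 2) :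
    zeta (paramMatrix a b β) x = (⨆ j, β (j, 0)) * |reduced a b x 0| := by
  rw [zeta, Real.iSup_mul_of_nonneg (abs_nonneg _)]
  exact iSup_congr fun j => hx.distInt_eq hβ j

lemma iSup_mem_Icc [NeZero n] {β : Fin n × Fin (k + 1) → ℝ} (hβ : ∀ p, β p ∈ Set.Icc (1 : ℝ) 2) :
    (⨆ j, β (j, 0)) ∈ Set.Icc (1 : ℝ) 2 :=
  ⟨(hβ (0, 0)).1.trans (le_ciSup (f := fun j => β (j, 0)) (Set.finite_range _).bddAbove 0),
    ciSup_le fun j => (hβ (j, 0)).2⟩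

/-- Singularity of `(a, b)`: below every large height `h` there are vectors with `ζ` smaller than
the bound that generic parameters guarantee off `leadingSubspace`. -/
lemma eventually_exists_zeta_lt [NeZero n] {a b : ℝ}
    (hab : ∀ N : ℕ, ∀ᶠ X : ℕ in atTop, ∃ p q r : ℤ, (p ≠ 0 ∨ q ≠ 0) ∧ |p| ≤ X ∧ |q| ≤ X ∧
      |r| ≤ X ∧ |(p : ℝ) * a + q * b + r| * (2 * X + 1) ^ N < 1 / 2)
    {β : Fin n × Fin (k + 1) → ℝ} (hβ : ∀ p, β p ∈ Set.Icc (1 : ℝ) 2) :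
    ∀ᶠ h : ℕ in atTop, ∃ u, 0 < height u ∧ height u ≤ h ∧
      zeta (paramMatrix a b β) u < 1 / (2 * h + 1 : ℝ) ^ (k + 5) := by
  filter_upwards [hab (k + 5), eventually_ge_atTop 1] with h hh h1
  obtain ⟨p, q, r, hpq, hp, hq, hr, hlt⟩ := hh
  set u : Fin (k + 3) → ℤ := Fin.cons p (Fin.cons q (Fin.cons r fun _ : Fin k => 0)) with hu
  have hred0 : reduced a b u 0 = p * a + q * b + r := rfl
  have hpow : (2 : ℝ) ≤ (2 * h + 1) ^ (k + 5) := by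
    have : (2 : ℝ) ≤ 2 * h + 1 := by
      have : (1 : ℝ) ≤ h := by exact_mod_cast h1
      linarith
    exact this.trans (le_self_pow₀ (by linarith) (by omega))
  have hneg : IsReducedSmall a b u := by
    intro i
    refine Fin.cases ?_ (fun i => ?_) i
    · rw [hred0]
      nlinarith [abs_nonneg ((p : ℝ) * a + q * b + r)]
    · have : reduced a b u i.succ = ((0 : ℤ) : ℝ) := rfl
      rw [this]
      norm_num
  refine ⟨u, ?_, ?_, ?_⟩
  · rw [height_pos_iff]
    intro h0
    have hp0 : p = 0 := congr_fun h0 0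
    have hq0 : q = 0 := congr_fun h0 1
    tauto
  · rw [height_le_iff]
    intro i
    refine Fin.cases ?_ (fun i => Fin.cases ?_ (fun i => Fin.cases ?_ (fun i => ?_) i) i) i
    · change p.natAbs ≤ h; rw [Int.abs_eq_natAbs] at hp; omega
    · change q.natAbs ≤ h; rw [Int.abs_eq_natAbs] at hq; omega
    · change r.natAbs ≤ h; rw [Int.abs_eq_natAbs] at hr; omega
    · change (0 : ℤ).natAbs ≤ h; simp
  · rw [hneg.zeta_eq hβ, hred0, lt_div_iff₀ (by positivity)]
    have := (iSup_mem_Icc hβ).2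
    have h0 : 0 ≤ |(p : ℝ) * a + q * b + r| * (2 * h + 1) ^ (k + 5) := by positivity
    nlinarith

/-- Two integer points `x`, `y` of a real plane with normal vector `c`, and their values
`e`, `e'` under the form `x₀ a + x₁ b + x₂`. Unless `e' x = e y`, the vector product of `x` and `y`
is a nonzero multiple of `c` and has a coordinate of absolute value at least `1`, so `e' x - e y`,
its vector product with `(a, b, 1)`, cannot be small compared with that of `c`. The first two
coordinates are enough, as their vanishing makes `c` a multiple of `(a, b, 1)`. -/
lemma abs_cross_le_of_mem_plane {a b c₀ c₁ c₂ η e e' : ℝ} {x₀ x₁ x₂ y₀ y₁ y₂ : ℤ}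
    (he : e = x₀ * a + x₁ * b + x₂) (he' : e' = y₀ * a + y₁ * b + y₂)
    (hx : c₀ * x₀ + c₁ * x₁ + c₂ * x₂ = 0) (hy : c₀ * y₀ + c₁ * y₁ + c₂ * y₂ = 0)
    (h₀ : |x₀ * e' - y₀ * e| ≤ η) (h₁ : |x₁ * e' - y₁ * e| ≤ η)
    (hne : ¬ (x₀ * e' - y₀ * e = 0 ∧ x₁ * e' - y₁ * e = 0 ∧ x₂ * e' - y₂ * e = 0)) :
    |b * c₂ - c₁| ≤ (|c₀| + |c₁| + |c₂|) * η ∧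
      |c₀ - a * c₂| ≤ (|c₀| + |c₁| + |c₂|) * η := by
  have hη : 0 ≤ η := (abs_nonneg _).trans h₀
  have key : ∀ (D : ℤ) (c E F : ℝ), D ≠ 0 → |c| ≤ |c₀| + |c₁| + |c₂| → |E| ≤ η →
      c * E = D * F → |F| ≤ (|c₀| + |c₁| + |c₂|) * η := by
    intro D c E F hD hc hE h
    have hD1 : (1 : ℝ) ≤ |(D : ℝ)| := by exact_mod_cast Int.one_le_abs hD
    calc |F| ≤ |(D : ℝ)| * |F| := le_mul_of_one_le_left (abs_nonneg _) hD1
      _ = |c| * |E| := by rw [← abs_mul, ← h, abs_mul]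
      _ ≤ (|c₀| + |c₁| + |c₂|) * η := by gcongr
  have hc0 : |c₀| ≤ |c₀| + |c₁| + |c₂| := by linarith [abs_nonneg c₁, abs_nonneg c₂]
  have hc1 : |c₁| ≤ |c₀| + |c₁| + |c₂| := by linarith [abs_nonneg c₀, abs_nonneg c₂]
  have hc2 : |c₂| ≤ |c₀| + |c₁| + |c₂| := by linarith [abs_nonneg c₁, abs_nonneg c₀]
  subst he he'
  by_cases d0 : x₁ * y₂ - x₂ * y₁ = 0
  · by_cases d1 : x₂ * y₀ - x₀ * y₂ = 0
    · by_cases d2 : x₀ * y₁ - x₁ * y₀ = 0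
      · have d0' : (x₁ * y₂ - x₂ * y₁ : ℝ) = 0 := by exact_mod_cast d0
        have d1' : (x₂ * y₀ - x₀ * y₂ : ℝ) = 0 := by exact_mod_cast d1
        have d2' : (x₀ * y₁ - x₁ * y₀ : ℝ) = 0 := by exact_mod_cast d2
        refine absurd ⟨?_, ?_, ?_⟩ hne
        · linear_combination b * d2' - d1'
        · linear_combination d0' - a * d2'
        · linear_combination a * d1' - b * d0'
      · refine ⟨key _ c₂ _ _ d2 hc2 h₀ ?_, key _ c₂ _ _ d2 hc2 h₁ ?_⟩ <;>
          push_cast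
        · linear_combination (x₀ * hy - y₀ * hx)
        · linear_combination (x₁ * hy - y₁ * hx)
    · refine ⟨key _ c₁ _ _ d1 hc1 h₀ ?_, key _ c₁ _ _ d1 hc1 h₁ ?_⟩ <;>
        push_cast
      · linear_combination b * (x₀ * hy - y₀ * hx)
      · linear_combination -(x₂ * hy - y₂ * hx) - a * (x₀ * hy - y₀ * hx)
  · refine ⟨key _ c₀ _ _ d0 hc0 h₀ ?_, key _ c₀ _ _ d0 hc0 h₁ ?_⟩ <;>
      push_cast
    · linear_combination -b * (x₁ * hy - y₁ * hx) - (x₂ * hy - y₂ * hx)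
    · linear_combination a * (x₁ * hy - y₁ * hx)

end

/-! ### The best approximations span three dimensions -/

section

open Filter Topology

variable {n k : ℕ}

lemma eventually_isReducedSmall_of_isBest {a b : ℝ} {β : Fin n × Fin (k + 1) → ℝ}
    (hup : ∀ᶠ h : ℕ in atTop, ∃ u, 0 < height u ∧ height u ≤ h ∧
      zeta (paramMatrix a b β) u < 1 / (2 * h + 1 : ℝ) ^ (k + 5))
    (hlow : ∀ᶠ h : ℕ in atTop, ∀ x, height x ≤ h → (∃ i, 1 / 4 ≤ |reduced a b x i|) →
      1 / (2 * h + 1 : ℝ) ^ (k + 5) ≤ zeta (paramMatrix a b β) x) :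
    ∀ᶠ h : ℕ in atTop, ∀ x, IsBest (paramMatrix a b β) x → height x = h →
      IsReducedSmall a b x := by
  filter_upwards [hup, hlow] with h ⟨u, hu, huh, hlt⟩ hl x hx hxh i
  by_contra! hi
  exact absurd (hx.2 u hu (huh.trans hxh.ge)) (not_le.2 (hlt.trans_le (hl x hxh.le ⟨i, hi⟩)))

lemma IsBestSeq.eventually_height {m : ℕ} {Θ : Matrix (Fin n) (Fin m) ℝ} {x : ℕ → Fin m → ℤ}
    (hx : IsBestSeq Θ x) {P : ℕ → Prop} (hP : ∀ᶠ h in atTop, P h) :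
    ∀ᶠ ν in atTop, P (height (x ν)) :=
  hx.height_lt.tendsto_atTop.eventually hP

/-- `2 h(x_{ν+1}) |x_ν,₀ a + x_ν,₁ b + x_ν,₂|` is at most `2 / (ν + 1)`: the vector provided by
singularity just below the height of `x_{ν+1}` is no better than `x_ν`. -/
lemma IsBestSeq.eventually_height_mul_le [NeZero n] {a b : ℝ} {β : Fin n × Fin (k + 1) → ℝ}
    (hβ : ∀ p, β p ∈ Set.Icc (1 : ℝ) 2) {x : ℕ → Fin (k + 3) → ℤ}
    (hx : IsBestSeq (paramMatrix a b β) x)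
    (hneg : ∀ᶠ ν in atTop, IsReducedSmall a b (x ν))
    (hup : ∀ᶠ h : ℕ in atTop, ∃ u, 0 < height u ∧ height u ≤ h ∧
      zeta (paramMatrix a b β) u < 1 / (2 * h + 1 : ℝ) ^ (k + 5)) :
    ∀ᶠ ν in atTop, 2 * height (x (ν + 1)) * |reduced a b (x ν) 0| ≤ 2 * (1 / ((ν : ℝ) + 1)) := by
  have hup' := (tendsto_sub_atTop_nat 1).eventually hup
  have hup'' := (tendsto_add_atTop_nat 1).eventually (hx.eventually_height hup')
  filter_upwards [hneg, hup''] with ν hν ⟨u, hu, huh, hlt⟩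
  set H := height (x (ν + 1)) with hH
  have hHν : ν + 1 ≤ H := hx.height_lt.le_apply
  have hle : |reduced a b (x ν) 0| ≤ zeta (paramMatrix a b β) u := by
    refine le_trans ?_ (hx.zeta_le (ν := ν) hu (by omega))
    rw [hν.zeta_eq hβ]
    exact le_mul_of_one_le_left (abs_nonneg _) (iSup_mem_Icc hβ).1
  have hH1 : (1 : ℝ) ≤ H := by exact_mod_cast (by omega : 1 ≤ H)
  have hHν' : (ν : ℝ) + 1 ≤ H := by exact_mod_cast hHν
  have hbase : (H : ℝ) ≤ 2 * ((H - 1 : ℕ) : ℝ) + 1 := by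
    rw [Nat.cast_sub (by omega)]
    push_cast
    linarith
  have hpow : (H : ℝ) * ((ν : ℝ) + 1) ≤ (2 * ((H - 1 : ℕ) : ℝ) + 1) ^ (k + 5) :=
    calc (H : ℝ) * ((ν : ℝ) + 1) ≤ (H : ℝ) ^ 2 := by nlinarith
      _ ≤ (H : ℝ) ^ (k + 5) := pow_le_pow_right₀ hH1 (by omega)
      _ ≤ _ := by gcongr
  have h1 : |reduced a b (x ν) 0| ≤ 1 / ((H : ℝ) * ((ν : ℝ) + 1)) :=
    (hle.trans hlt.le).trans (by gcongr)
  calc 2 * H * |reduced a b (x ν) 0| ≤ 2 * H * (1 / ((H : ℝ) * ((ν : ℝ) + 1))) := by gcongr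
    _ = 2 * (1 / ((ν : ℝ) + 1)) := by field_simp

/-- The best approximations do not eventually lie in a plane through the origin. -/
lemma IsBestSeq.not_eventually_mem_plane [NeZero n] {a b : ℝ}
    (hab : ∀ p q r : ℤ, (p : ℝ) * a + q * b + r = 0 → p = 0 ∧ q = 0 ∧ r = 0)
    {β : Fin n × Fin (k + 1) → ℝ}
    (hβ : ∀ p, β p ∈ Set.Icc (1 : ℝ) 2) {x : ℕ → Fin (k + 3) → ℤ}
    (hx : IsBestSeq (paramMatrix a b β) x)
    (hneg : ∀ᶠ ν in atTop, IsReducedSmall a b (x ν))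
    (hup : ∀ᶠ h : ℕ in atTop, ∃ u, 0 < height u ∧ height u ≤ h ∧
      zeta (paramMatrix a b β) u < 1 / (2 * h + 1 : ℝ) ^ (k + 5))
    {c₀ c₁ c₂ : ℝ} (hc : ¬ (c₀ = 0 ∧ c₁ = 0 ∧ c₂ = 0)) :
    ¬ ∀ᶠ ν in atTop, c₀ * x ν 0 + c₁ * x ν 1 + c₂ * x ν 2 = 0 := by
  intro hplane
  have hneg' := (tendsto_add_atTop_nat 1).eventually hneg
  have hplane' := (tendsto_add_atTop_nat 1).eventually hplane
  set C := |c₀| + |c₁| + |c₂|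
  have hbound : ∀ᶠ ν : ℕ in atTop,
      |b * c₂ - c₁| ≤ C * (2 * (1 / ((ν : ℝ) + 1))) ∧
      |c₀ - a * c₂| ≤ C * (2 * (1 / ((ν : ℝ) + 1))) := by
    filter_upwards [hneg, hneg', hplane, hplane', hx.eventually_height_mul_le hβ hneg hup]
      with ν hn hn' hp hp' hη
    set e := reduced a b (x ν) 0
    set e' := reduced a b (x (ν + 1)) 0
    have hpos : 0 < height (x (ν + 1)) := (hx.isBest _).1
    have hht : (height (x ν) : ℝ) < height (x (ν + 1)) := by
      exact_mod_cast hx.height_lt (Nat.lt_succ_self ν)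
    have hee : |e'| < |e| := by
      have hz := hx.zeta_gt (Nat.lt_succ_self ν)
      simp only [Nat.succ_eq_add_one] at hz
      rw [hn.zeta_eq hβ, hn'.zeta_eq hβ] at hz
      exact lt_of_mul_lt_mul_left hz (by linarith [(iSup_mem_Icc hβ).1])
    have hE : ∀ i, |x ν i * e' - x (ν + 1) i * e| ≤ 2 * (1 / ((ν : ℝ) + 1)) := by
      intro i
      refine le_trans ?_ hη
      have h1 := abs_le_height (x ν) i
      have h2 := abs_le_height (x (ν + 1)) i
      have h3 := abs_nonneg e
      have h4 := abs_nonneg e'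
      calc |x ν i * e' - x (ν + 1) i * e| ≤ |(x ν i : ℝ)| * |e'| + |(x (ν + 1) i : ℝ)| * |e| := by
            rw [← abs_mul, ← abs_mul]; exact abs_sub _ _
        _ ≤ height (x (ν + 1)) * |e| + height (x (ν + 1)) * |e| := by
            gcongr
            exact h1.trans hht.le
        _ = _ := by ring
    refine abs_cross_le_of_mem_plane (e := e) (e' := e') rfl rfl hp hp' (hE 0) (hE 1) ?_
    -- A coordinate of `x (ν + 1)` of largest absolute value gives `e' x_ν ≠ e x_{ν+1}`.
    rintro ⟨z0, z1, z2⟩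
    obtain ⟨i, hi⟩ := exists_abs_eq_height hpos
    have hzero : x ν i * e' - x (ν + 1) i * e = 0 :=
      Fin.cases z0 (fun i => Fin.cases z1 (fun i => Fin.cases z2 (fun i => by
        rw [hn.apply_eq_zero, hn'.apply_eq_zero]; simp) i) i) i
    have heq : |(x ν i : ℝ)| * |e'| = height (x (ν + 1)) * |e| := by
      rw [← hi, ← abs_mul, ← abs_mul, sub_eq_zero.1 hzero]
    have hposR : (0 : ℝ) < height (x (ν + 1)) := by exact_mod_cast hpos
    have h1 := abs_le_height (x ν) i
    have h4 := abs_nonneg e'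
    nlinarith
  have hlim : Tendsto (fun ν : ℕ => C * (2 * (1 / ((ν : ℝ) + 1)))) atTop (𝓝 0) := by
    simpa using (tendsto_one_div_add_atTop_nhds_zero_nat (𝕜 := ℝ)).const_mul 2 |>.const_mul C
  have hF0 : b * c₂ - c₁ = 0 :=
    abs_nonpos_iff.1 (ge_of_tendsto hlim (hbound.mono fun _ h => h.1))
  have hF1 : c₀ - a * c₂ = 0 :=
    abs_nonpos_iff.1 (ge_of_tendsto hlim (hbound.mono fun _ h => h.2))
  -- So the normal vector is `c₂ (a, b, 1)`, which annihilates no nonzero integer vector.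
  obtain ⟨ν, hn, hp⟩ := (hneg.and hplane).exists
  have hc2 : c₂ * reduced a b (x ν) 0 = 0 := by
    change c₂ * (x ν 0 * a + x ν 1 * b + x ν 2) = 0
    linear_combination hp + x ν 1 * hF0 - x ν 0 * hF1
  rcases mul_eq_zero.1 hc2 with h | h
  · rw [h, mul_zero, sub_zero] at hF1
    rw [h, mul_zero, zero_sub, neg_eq_zero] at hF0
    exact hc ⟨hF1, hF0, h⟩
  · refine (height_pos_iff.1 (hx.isBest ν).1) (reduced_eq_zero hab (a := a) (b := b) ?_)
    ext i
    refine Fin.cases h (fun i => ?_) i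
    simp [reduced, hn.apply_eq_zero]

/-- A real subspace of dimension less than `3` projects to a proper subspace of the first three
coordinates, hence into a plane. -/
lemma exists_plane_of_finrank_lt {W : Submodule ℝ (Fin (k + 3) ⊕ Fin n → ℝ)}
    (hW : Module.finrank ℝ W < 3) :
    ∃ c₀ c₁ c₂ : ℝ, ¬ (c₀ = 0 ∧ c₁ = 0 ∧ c₂ = 0) ∧
      ∀ v ∈ W, c₀ * v (Sum.inl 0) + c₁ * v (Sum.inl 1) + c₂ * v (Sum.inl 2) = 0 := by
  set π : (Fin (k + 3) ⊕ Fin n → ℝ) →ₗ[ℝ] (Fin 3 → ℝ) :=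
    LinearMap.funLeft ℝ ℝ ![Sum.inl 0, Sum.inl 1, Sum.inl 2] with hπ
  have hlt : W.map π < ⊤ := by
    rw [lt_top_iff_ne_top]
    intro htop
    have h1 := Submodule.finrank_map_le π W
    rw [htop, finrank_top, Module.finrank_fin_fun] at h1
    omega
  obtain ⟨f, hf0, hf⟩ := Submodule.exists_le_ker_of_lt_top _ hlt
  have hfv : ∀ w : Fin 3 → ℝ, f w = f (Pi.single 0 1) * w 0 + f (Pi.single 1 1) * w 1 +
      f (Pi.single 2 1) * w 2 := by
    intro w
    rw [LinearMap.pi_apply_eq_sum_univ f w, Fin.sum_univ_three]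
    have : ∀ i : Fin 3, (fun j => if i = j then (1 : ℝ) else 0) = Pi.single i 1 := by
      intro i; ext j; simp [Pi.single_apply, eq_comm]
    simp only [this, smul_eq_mul]
    ring
  refine ⟨f (Pi.single 0 1), f (Pi.single 1 1), f (Pi.single 2 1), ?_, ?_⟩
  · rintro ⟨h0, h1, h2⟩
    refine hf0 (LinearMap.ext fun w => ?_)
    rw [hfv, h0, h1, h2]
    simp
  · intro v hv
    have : f (π v) = 0 := hf (Submodule.mem_map_of_mem hv)
    rw [hfv] at this
    exact this

end

end

end BestApprox

open BestApprox Filter in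
theorem mainTheorem7 (m n : ℕ) (hm : 3 ≤ m) (hn : 1 ≤ n) :
    ∃ Θ : Matrix (Fin n) (Fin m) ℝ,
      BestApprox.EntriesIndep Θ ∧
      BestApprox.IsRegular Θ ∧
      (∃ V : Submodule ℝ (Fin m ⊕ Fin n → ℝ), Module.finrank ℝ V = 3 ∧
        ∀ x : ℕ → Fin m → ℤ, BestApprox.IsBestSeq Θ x →
          ∃ ν₀, ∀ ν ≥ ν₀, BestApprox.toReal (BestApprox.extVec Θ (x ν)) ∈ V) ∧
      BestApprox.R Θ = 3 := by
  obtain ⟨k, rfl⟩ := Nat.exists_eq_add_of_le' hm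
  have : NeZero n := ⟨by omega⟩
  obtain ⟨a, b, hab, hsing⟩ := exists_singular_pair
  obtain ⟨β, hβ, hΘ, hlow⟩ := exists_generic_param (n := n) (k := k) hab
  have hup := eventually_exists_zeta_lt hsing hβ
  have hneg : ∀ x, IsBestSeq (paramMatrix a b β) x → ∀ᶠ ν in atTop, IsReducedSmall a b (x ν) :=
    fun x hx => (hx.eventually_height (eventually_isReducedSmall_of_isBest hup hlow)).mono
      fun ν h => h _ (hx.isBest ν) rfl
  have hreg : IsRegular (paramMatrix a b β) := by
    refine hΘ.isRegular fun ε hε => ?_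
    obtain ⟨N, hN⟩ := exists_nat_one_div_lt hε
    obtain ⟨h, ⟨u, hu, -, hlt⟩, hNh⟩ := (hup.and (eventually_ge_atTop N)).exists
    refine ⟨u, hu, hlt.trans_le (le_trans ?_ hN.le)⟩
    have hNh' : (N : ℝ) ≤ h := by exact_mod_cast hNh
    have hh : (0 : ℝ) ≤ h := Nat.cast_nonneg h
    gcongr
    calc (N : ℝ) + 1 ≤ 2 * h + 1 := by linarith
      _ ≤ (2 * h + 1) ^ (k + 5) := le_self_pow₀ (by linarith) (by omega)
  have hmem : ∀ x, IsBestSeq (paramMatrix a b β) x →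
      ∃ ν₀, ∀ ν ≥ ν₀, toReal (extVec (paramMatrix a b β) (x ν)) ∈ leadingSubspace n k :=
    fun x hx => eventually_atTop.1 ((hneg x hx).mono fun ν h => h.toReal_extVec_mem hβ)
  refine ⟨paramMatrix a b β, hΘ, hreg, ⟨leadingSubspace n k, finrank_leadingSubspace, hmem⟩, ?_⟩
  have h3 : 3 ∈ {r : ℕ | ∃ Λ : AddSubgroup (Fin (k + 3) ⊕ Fin n → ℤ), latticeDim Λ = r ∧
      ∀ x : ℕ → Fin (k + 3) → ℤ, IsBestSeq (paramMatrix a b β) x →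
        ∃ ν₀, ∀ ν ≥ ν₀, extVec (paramMatrix a b β) (x ν) ∈ Λ} :=
    ⟨leadingLattice n k, latticeDim_leadingLattice, hmem⟩
  refine le_antisymm (Nat.sInf_le h3) (le_csInf ⟨3, h3⟩ ?_)
  rintro r ⟨Λ, rfl, hΛ⟩
  obtain ⟨x, hx, -⟩ := hreg
  by_contra! hlt
  obtain ⟨c₀, c₁, c₂, hc, hplane⟩ := exists_plane_of_finrank_lt hlt
  refine hx.not_eventually_mem_plane hab hβ (hneg x hx) hup hc ?_
  filter_upwards [eventually_atTop.2 (hΛ x hx)] with ν hν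
  exact hplane _ (Submodule.subset_span ⟨_, hν, rfl⟩)
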